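/- Let $k$ be a field and let $A=\bigoplus_{n\ge 0}A_n$ be a connected graded associative $k$-algebra: $A_0=k$ and every $A_n$ is finite-dimensional. For a graded space $V$ with finite-dimensional components write $V(t)=\sum_{n\ge 0}\dim(V_n)\,t^n$ for its Hilbert series and $r(V)\in[0,\infty]$ for the radius of convergence of $V(t)$. Assume $r(A)>0$. Let $S\subset A$ be a non-empty set of homogeneous elements of positive degree which minimally generates the two-sided ideal $I=ASA$ (no proper subset of $S$ generates $I$). Let $B=A/I$ with the induced grading, and let $C=B*k\langle S\rangle$ be the free product of $B$ and the free algebra on $S$, graded so that each generator $s\in S$ has the degree of $s$ in $A$. The set $S$ is called strongly free if $C(t)=A(t)$. Then all components of $C$ are finite-dimensional, and $$ r(A)\ \ge\ r(C). $$ If $S$ is strongly free, then $r(A)=r(C)$. Suppose moreover that the algebra $A$ is finitely generated or, more generally, that the Hilbert series of $A$ diverges at its radius of convergence, $A(r(A))=\infty$. Then $r(A)=r(C)$ if and only if $S$ is strongly free. -/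

import Mathlib

open scoped ENNReal

namespace GradedGrowth

universe u v w

section Hilbert

variable {k : Type u} [Field k] {V : Type v} [AddCommMonoid V] [Module k V]

/-- The Hilbert series `∑ dim Vₙ tⁿ` of a graded space with components `𝒱 n`. -/
noncomputable def hilbertSeries (𝒱 : ℕ → Submodule k V) : PowerSeries ℕ :=
  PowerSeries.mk fun n => Module.finrank k (𝒱 n)

/-- The radius of convergence, in `[0, ∞]`, of a power series with natural coefficients. -/
noncomputable def radius (f : PowerSeries ℕ) : ℝ≥0∞ :=
  (FormalMultilinearSeries.ofScalars ℝ fun n => ((PowerSeries.coeff n f : ℕ) : ℝ)).radius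

/-- The value in `[0, ∞]` at `t ∈ [0, ∞]` of a power series with natural coefficients. -/
noncomputable def valueAt (f : PowerSeries ℕ) (t : ℝ≥0∞) : ℝ≥0∞ :=
  ∑' n, ((PowerSeries.coeff n f : ℕ) : ℝ≥0∞) * t ^ n

end Hilbert

/-- A connected locally finite grading: the degree zero component is `k` (so `1 ≠ 0`), and all
components are finite-dimensional. -/
structure IsConnectedGrading {k : Type u} [Field k] {A : Type v} [Ring A] [Algebra k A]
    (𝒜 : ℕ → Submodule k A) : Prop where
  nontrivial : Nontrivial A
  zero_eq : 𝒜 0 = LinearMap.range (Algebra.linearMap k A)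
  finite : ∀ n, FiniteDimensional k (𝒜 n)

/-- `S` generates the two-sided ideal `I`, and no proper subset of `S` does. -/
def MinimallyGenerates {A : Type v} [Ring A] (S : Set A) (I : TwoSidedIdeal A) : Prop :=
  TwoSidedIdeal.span S = I ∧ ∀ T : Set A, T ⊂ S → TwoSidedIdeal.span T ≠ I

section Quotient

variable {k : Type u} [Field k] {A : Type v} [Ring A] [Algebra k A]

/-- The quotient algebra `A / I`. -/
abbrev QuotientAlgebra (I : TwoSidedIdeal A) : Type v := I.ringCon.Quotient

/-- The grading of `A / I` by the images of the components of `A`. -/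
def quotientGrading (𝒜 : ℕ → Submodule k A) (I : TwoSidedIdeal A) :
    ℕ → Submodule k (QuotientAlgebra I) :=
  fun n => (𝒜 n).map (RingCon.mkₐ k I.ringCon).toLinearMap

end Quotient

/-- The grading of the free algebra `k⟨S⟩` in which the generator `s` has degree `deg s`. -/
def freeGrading (k : Type u) [Field k] {S : Type v} (deg : S → ℕ) :
    ℕ → Submodule k (FreeAlgebra k S) :=
  fun n => Submodule.span k
    {x | ∃ l : List S, (l.map deg).sum = n ∧ x = (l.map (FreeAlgebra.ι k)).prod}

section FreeProduct

/-- The two factors of a binary free product, as a family over `Bool` in a common universe. -/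
def Factor (X : Type v) (Y : Type w) : Bool → Type (max v w)
  | false => ULift.{w} X
  | true => ULift.{v} Y

variable (k : Type u) [Field k] (X : Type v) (Y : Type w)
  [Ring X] [Ring Y] [Algebra k X] [Algebra k Y]

instance instRingFactor : ∀ i, Ring (Factor X Y i)
  | false => inferInstanceAs (Ring (ULift X))
  | true => inferInstanceAs (Ring (ULift Y))

instance instAlgebraFactor : ∀ i, Algebra k (Factor X Y i)
  | false => inferInstanceAs (Algebra k (ULift X))
  | true => inferInstanceAs (Algebra k (ULift Y))

/-- The free product (coproduct of associative unital `k`-algebras) `X * Y`. -/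
abbrev FreeProd : Type (max u v w) := LinearAlgebra.FreeProduct k (Factor X Y)

/-- The canonical homomorphism `X → X * Y`. -/
noncomputable def inl : X →ₐ[k] FreeProd k X Y :=
  (LinearAlgebra.FreeProduct.ι k (Factor X Y) false).comp
    (ULift.algEquiv (R := k) (A := X)).symm.toAlgHom

/-- The canonical homomorphism `Y → X * Y`. -/
noncomputable def inr : Y →ₐ[k] FreeProd k X Y :=
  (LinearAlgebra.FreeProduct.ι k (Factor X Y) true).comp
    (ULift.algEquiv (R := k) (A := Y)).symm.toAlgHom

variable {k X Y}

/-- `IsWord 𝒳 𝒴 n c`: the element `c` of `X * Y` is a product of homogeneous elements of the two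
factors whose degrees add up to `n`. -/
inductive IsWord (𝒳 : ℕ → Submodule k X) (𝒴 : ℕ → Submodule k Y) : ℕ → FreeProd k X Y → Prop
  | one : IsWord 𝒳 𝒴 0 1
  | inl_mul {d n : ℕ} {x : X} {c : FreeProd k X Y} (hx : x ∈ 𝒳 d) (hc : IsWord 𝒳 𝒴 n c) :
      IsWord 𝒳 𝒴 (d + n) (inl k X Y x * c)
  | inr_mul {d n : ℕ} {y : Y} {c : FreeProd k X Y} (hy : y ∈ 𝒴 d) (hc : IsWord 𝒳 𝒴 n c) :
      IsWord 𝒳 𝒴 (d + n) (inr k X Y y * c)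

/-- The grading of `X * Y` induced by gradings of the factors. -/
def freeProdGrading (𝒳 : ℕ → Submodule k X) (𝒴 : ℕ → Submodule k Y) :
    ℕ → Submodule k (FreeProd k X Y) :=
  fun n => Submodule.span k {c | IsWord 𝒳 𝒴 n c}

end FreeProduct

section StronglyFree

variable {k : Type u} [Field k] {A : Type v} [Ring A] [Algebra k A]

/-- The grading of `C = (A / I) * k⟨S⟩`, where the generator `s` has degree `deg s`. -/
noncomputable def comparisonGrading (𝒜 : ℕ → Submodule k A) (I : TwoSidedIdeal A) (S : Set A)
    (deg : S → ℕ) : ℕ → Submodule k (FreeProd k (QuotientAlgebra I) (FreeAlgebra k S)) :=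
  freeProdGrading (quotientGrading 𝒜 I) (freeGrading k deg)

/-- A set `S` of homogeneous elements (`s` having degree `deg s`) is strongly free in `A` if
`A` and `(A / ASA) * k⟨S⟩` have the same Hilbert series. -/
def StronglyFree (𝒜 : ℕ → Submodule k A) (S : Set A) (deg : S → ℕ) : Prop :=
  hilbertSeries (comparisonGrading 𝒜 (TwoSidedIdeal.span S) S deg) = hilbertSeries 𝒜

end StronglyFree

end GradedGrowth

/-!
Let `β` index a homogeneous basis of `B = A / I`, lifted to homogeneous elements `σ(b)` of `A`, and
consider the normal words `b₀ s₁ b₁ ⋯ sₙ bₙ` with `bᵢ ∈ β` and `sᵢ ∈ S`. In the free product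
`C = B * k⟨S⟩` they form a basis (`freeProdGrading_eq_span`, `linearIndependent_normalWord`; for the
independence, `C` acts on the space of words). In `A` the elements `σ(b₀) s₁ σ(b₁) ⋯ sₙ σ(bₙ)` span
every component (`le_span_normalWord`), and minimality of `S` makes `S`, hence the set of normal
words, finite in each degree. So `dim Aₙ ≤ dim Cₙ < ∞`, which gives `r(A) ≥ r(C)`.

Assume that `r(A) = r(C) = r` but `C(t) ≠ A(t)`. Then some normal words are linearly dependent
in `A`. Let `W(t)` be the generating function of the letters `(s, b)`, so that
`C(t) = B(t) (1 + W + W² + ⋯)`. From a shortest word of the relation one obtains a word `w₀` in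
these letters, of length `P` and degree `m`, whose product in `A` is a combination of other words of
the same length and of longer words (`exists_wordProd_mem_span`). Rewriting the last `P` letters of
a word repeatedly, which ends because the degree is fixed, one finds
`A(t) ≤ B(t) (1 + W + ⋯ + Wᴾ⁻¹) + (Wᴾ - tᵐ) A(t)` (`le_span_of_wordProd_mem_span`). For `t < r` the
series `C(t)` converges, so `W(t) < 1` and `A(t) tᵐ ≤ P B(t)`, where `B(t) tᵈ ≤ W(t) < 1` for the
degree `d` of any element of `S`. Letting `t → r` shows that `A(r)` is finite
(`valueAt_ne_top_of_not_linearIndependent`), contrary to `A(r) = ∞`.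

For a finitely generated algebra with `r < ∞` the divergence `A(r) = ∞` is automatic
(`valueAt_radius_eq_top_of_finiteType`): a long monomial has a left factor whose degree lies in any
prescribed interval of the length of the largest degree of a generator. The remaining
case `r(A) = ∞` does not meet `r(A) = r(C)`, since `r(C) ≤ 1` (`radius_le_one`).

Generating functions are evaluated in `[0, ∞]` as sums of `t ^ deg` over index sets, so that no
summability questions arise.
-/

namespace GradedGrowth

/-! ### Power series with natural coefficients -/

section PowerSeries

open scoped NNReal
open Filter Topology

theorem nnnorm_ofScalars_coeff (f : PowerSeries ℕ) (n : ℕ) :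
    ‖FormalMultilinearSeries.ofScalars ℝ (fun n => ((PowerSeries.coeff n f : ℕ) : ℝ)) n‖₊ =
      ((PowerSeries.coeff n f : ℕ) : ℝ≥0) :=
  NNReal.eq (by simp)

theorem radius_anti {f g : PowerSeries ℕ}
    (h : ∀ n, PowerSeries.coeff n f ≤ PowerSeries.coeff n g) : radius g ≤ radius f := by
  refine FormalMultilinearSeries.radius_le_of_le fun n => ?_
  simp only [FormalMultilinearSeries.ofScalars_norm, Real.norm_natCast]
  exact_mod_cast h n

theorem valueAt_ne_top_of_lt_radius {f : PowerSeries ℕ} {t : ℝ≥0} (h : (t : ℝ≥0∞) < radius f) :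
    valueAt f t ≠ ⊤ := by
  have h' := FormalMultilinearSeries.summable_nnnorm_mul_pow _ h
  rw [← ENNReal.tsum_coe_ne_top_iff_summable] at h'
  convert h' using 2
  refine tsum_congr fun n => ?_
  rw [nnnorm_ofScalars_coeff]
  push_cast
  rfl

theorem le_radius_of_valueAt_ne_top {f : PowerSeries ℕ} {t : ℝ≥0} (h : valueAt f t ≠ ⊤) :
    (t : ℝ≥0∞) ≤ radius f := by
  refine FormalMultilinearSeries.le_radius_of_summable_nnnorm _ ?_
  rw [← ENNReal.tsum_coe_ne_top_iff_summable]
  convert h using 2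
  refine tsum_congr fun n => ?_
  rw [nnnorm_ofScalars_coeff]
  push_cast
  rfl

/-- A bound of the form `f(t) tᴹ ≤ p` for all `0 < t < r` persists at `t = r`. -/
theorem valueAt_mul_pow_le_of_forall_lt {f : PowerSeries ℕ} {r p : ℝ≥0} {M : ℕ} (hr : 0 < r)
    (h : ∀ t : ℝ≥0, 0 < t → t < r → valueAt f t * (t : ℝ≥0∞) ^ M ≤ p) :
    valueAt f r * (r : ℝ≥0∞) ^ M ≤ p := by
  rw [valueAt, ← ENNReal.tsum_mul_right, ENNReal.tsum_eq_iSup_nat]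
  refine iSup_le fun N => ?_
  have key : ∑ n ∈ Finset.range N, ((PowerSeries.coeff n f : ℕ) : ℝ≥0) * r ^ n * r ^ M ≤ p := by
    have hc : Continuous fun t : ℝ≥0 =>
        ∑ n ∈ Finset.range N, ((PowerSeries.coeff n f : ℕ) : ℝ≥0) * t ^ n * t ^ M := by
      fun_prop
    have : (𝓝[<] r).NeBot := nhdsLT_neBot_of_exists_lt ⟨0, hr⟩
    refine le_of_tendsto ((hc.tendsto r).mono_left (nhdsWithin_le_nhds (s := Set.Iio r))) ?_
    filter_upwards [Ioo_mem_nhdsLT hr] with t ht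
    rw [← ENNReal.coe_le_coe]
    refine le_trans ?_ (h t ht.1 ht.2)
    rw [valueAt, ← ENNReal.tsum_mul_right]
    push_cast
    exact ENNReal.sum_le_tsum (f := fun n => ((PowerSeries.coeff n f : ℕ) : ℝ≥0∞) * t ^ n * t ^ M) _
  exact_mod_cast ENNReal.coe_le_coe.2 key

end PowerSeries

/-! ### Counting and generating functions of words -/

section Counting

theorem tsum_comp_eq_tsum_card {Y : Type*} (d : Y → ℕ) (g : ℕ → ℝ≥0∞) :
    ∑' y, g (d y) = ∑' n, (ENat.card {y // d y = n} : ℝ≥0∞) * g n := by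
  rw [← (Equiv.sigmaFiberEquiv d).tsum_eq, ENNReal.tsum_sigma']
  refine tsum_congr fun n => ?_
  rw [← ENNReal.tsum_const]
  refine tsum_congr fun y => ?_
  simp [Equiv.sigmaFiberEquiv, y.2]

theorem finrank_le_card_of_le_span {k M Y : Type*} [Field k] [AddCommGroup M] [Module k M]
    {V : Submodule k M} {f : Y → M} {s : Set Y} (h : V ≤ Submodule.span k (f '' s)) :
    (Module.finrank k V : ℕ∞) ≤ ENat.card s := by
  cases finite_or_infinite s with
  | inr _ => simp
  | inl hs =>
    have := Fintype.ofFinite s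
    have h' : V ≤ Submodule.span k (Set.range fun y : s => f y) := by
      rwa [Set.image_eq_range] at h
    rw [ENat.card_eq_coe_fintype_card]
    have := FiniteDimensional.span_of_finite k (Set.finite_range fun y : s => f y)
    exact_mod_cast (Submodule.finrank_mono h').trans (finrank_range_le_card _)

/-- If every component `Vₙ` is spanned by the elements `f y` with `d y = n`, then the Hilbert
series of `V` is bounded by the generating function of `d`, for arbitrary weights `g n` in place
of `tⁿ`. -/
theorem tsum_finrank_mul_le {k M Y : Type*} [Field k] [AddCommGroup M] [Module k M]
    {V : ℕ → Submodule k M} {f : Y → M} {d : Y → ℕ}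
    (h : ∀ n, V n ≤ Submodule.span k (f '' {y | d y = n})) (g : ℕ → ℝ≥0∞) :
    ∑' n, (Module.finrank k (V n) : ℝ≥0∞) * g n ≤ ∑' y, g (d y) := by
  rw [tsum_comp_eq_tsum_card]
  refine ENNReal.tsum_le_tsum fun n => mul_le_mul_left ?_ _
  have := finrank_le_card_of_le_span (h n)
  calc ((Module.finrank k (V n) : ℕ) : ℝ≥0∞)
      = (((Module.finrank k (V n) : ℕ) : ℕ∞) : ℝ≥0∞) := by simp
    _ ≤ _ := ENat.toENNReal_le.2 this

end Counting

section Words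

variable {L : Type*}

/-- The degree of a word, for letters of prescribed degrees. -/
def wordDeg (d : L → ℕ) (w : List L) : ℕ := (w.map d).sum

@[simp] theorem wordDeg_nil (d : L → ℕ) : wordDeg d [] = 0 := rfl

@[simp] theorem wordDeg_cons (d : L → ℕ) (l : L) (w : List L) :
    wordDeg d (l :: w) = d l + wordDeg d w := by simp [wordDeg]

@[simp] theorem wordDeg_append (d : L → ℕ) (v w : List L) :
    wordDeg d (v ++ w) = wordDeg d v + wordDeg d w := by simp [wordDeg]

theorem length_le_wordDeg {d : L → ℕ} (hd : ∀ l, 0 < d l) (w : List L) :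
    w.length ≤ wordDeg d w := by
  induction w with
  | nil => simp
  | cons l w ih => simp only [List.length_cons, wordDeg_cons]; have := hd l; omega

theorem le_wordDeg_of_mem {d : L → ℕ} {l : L} {w : List L} (h : l ∈ w) : d l ≤ wordDeg d w :=
  List.single_le_sum (by simp) _ (List.mem_map_of_mem h)

/-- If there are finitely many letters in each degree and all degrees are positive, there are
finitely many words in each degree. -/
theorem finite_wordDeg_le {d : L → ℕ} (hd : ∀ l, 0 < d l) (n : ℕ)
    (hfin : {l | d l ≤ n}.Finite) : {w | wordDeg d w ≤ n}.Finite := by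
  have := hfin.to_subtype
  refine ((List.finite_length_le {l | d l ≤ n} n).image (List.map Subtype.val)).subset ?_
  intro w hw
  have hmem : ∀ l ∈ w, l ∈ {l | d l ≤ n} := fun l hl => (le_wordDeg_of_mem hl).trans hw
  refine ⟨w.attach.map fun l => ⟨l.1, hmem l.1 l.2⟩, ?_, by simp [Function.comp_def]⟩
  change List.length _ ≤ n
  rw [List.length_map, List.length_attach]
  exact (length_le_wordDeg hd w).trans hw

/-- The words of length `n + 1` are pairs of a letter and a word of length `n`. -/
def wordConsEquiv (L : Type*) (n : ℕ) :
    L × {w : List L // w.length = n} ≃ {w : List L // w.length = n + 1} where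
  toFun p := ⟨p.1 :: p.2.1, by simp [p.2.2]⟩
  invFun w := match w with
    | ⟨l :: v, h⟩ => (l, ⟨v, by simpa using h⟩)
  left_inv p := rfl
  right_inv w := by
    obtain ⟨_ | ⟨l, v⟩, h⟩ := w
    · simp at h
    · rfl

theorem tsum_word_length (d : L → ℕ) (t : ℝ≥0∞) (n : ℕ) :
    ∑' w : {w : List L // w.length = n}, t ^ wordDeg d w.1 = (∑' l, t ^ d l) ^ n := by
  induction n with
  | zero =>
    rw [tsum_eq_single ⟨[], rfl⟩]
    · simp
    · rintro ⟨w, hw⟩ h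
      exact absurd (Subtype.ext (List.length_eq_zero_iff.1 hw)) h
  | succ n ih =>
    rw [← (wordConsEquiv L n).tsum_eq, ENNReal.tsum_prod', pow_succ', ← ih,
      ← ENNReal.tsum_mul_right]
    refine tsum_congr fun l => ?_
    rw [← ENNReal.tsum_mul_left]
    refine tsum_congr fun w => ?_
    simp [wordConsEquiv, pow_add]

theorem tsum_word (d : L → ℕ) (t : ℝ≥0∞) :
    ∑' w : List L, t ^ wordDeg d w = ∑' n, (∑' l, t ^ d l) ^ n := by
  rw [← (Equiv.sigmaFiberEquiv (List.length (α := L))).tsum_eq, ENNReal.tsum_sigma']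
  exact tsum_congr fun n => tsum_word_length d t n

/-- If the generating function of the words converges at `t`, that of the letters is less than `1`,
the former being the geometric series of the latter. -/
theorem tsum_letter_lt_one {d : L → ℕ} {t : ℝ≥0∞} (h : ∑' w : List L, t ^ wordDeg d w ≠ ⊤) :
    ∑' l, t ^ d l < 1 := by
  by_contra! hW
  rw [tsum_word] at h
  refine h (top_le_iff.1 ?_)
  calc (⊤ : ℝ≥0∞) = ∑' _ : ℕ, 1 := (ENNReal.tsum_const_eq_top_of_ne_zero one_ne_zero).symm
    _ ≤ _ := ENNReal.tsum_le_tsum fun n => one_le_pow₀ hW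

theorem tsum_word_length_lt_le (d : L → ℕ) {t : ℝ≥0∞} (hW : ∑' l, t ^ d l ≤ 1) (P : ℕ) :
    ∑' w : {w : List L // w.length < P}, t ^ wordDeg d w.1 ≤ P := by
  let e : (Σ i : Fin P, {w : List L // w.length = i}) ≃ {w : List L // w.length < P} :=
    { toFun := fun p => ⟨p.2.1, by rw [p.2.2]; exact p.1.2⟩
      invFun := fun w => ⟨⟨w.1.length, w.2⟩, ⟨w.1, rfl⟩⟩
      left_inv := by rintro ⟨⟨i, hi⟩, w, hw⟩; obtain rfl : w.length = i := hw; rfl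
      right_inv := fun w => rfl }
  rw [← e.tsum_eq, ENNReal.tsum_sigma']
  calc ∑' i : Fin P, ∑' w : {w : List L // w.length = i}, t ^ wordDeg d w.1
      ≤ ∑' _ : Fin P, (1 : ℝ≥0∞) := by
        refine ENNReal.tsum_le_tsum fun i => ?_
        rw [tsum_word_length]
        exact pow_le_one₀ zero_le hW
    _ = P := by simp

theorem tsum_word_length_ne_add (d : L → ℕ) (t : ℝ≥0∞) (w₀ : List L) :
    ∑' w : {w : List L // w.length = w₀.length ∧ w ≠ w₀}, t ^ wordDeg d w.1 + t ^ wordDeg d w₀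
      = (∑' l, t ^ d l) ^ w₀.length := by
  classical
  let e : {w : List L // w.length = w₀.length ∧ w ≠ w₀} ⊕ Unit ≃
      {w : List L // w.length = w₀.length} :=
    { toFun := Sum.elim (fun w => ⟨w.1, w.2.1⟩) fun _ => ⟨w₀, rfl⟩
      invFun := fun w => if h : w.1 = w₀ then Sum.inr () else Sum.inl ⟨w.1, w.2, h⟩
      left_inv := by
        rintro (⟨w, h1, h2⟩ | ⟨⟩)
        · simp [h2]
        · simp
      right_inv := by
        rintro ⟨w, h⟩
        by_cases hw : w = w₀
        · subst hw; simp
        · simp [hw] }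
  rw [← tsum_word_length, ← e.tsum_eq, ENNReal.summable.tsum_sum ENNReal.summable]
  simp [e]

/-- If a series with value `a < ∞` satisfies `a ≤ b (1 + W + ⋯ + Wᴾ⁻¹) + (Wᴾ - tᵐ) a`, where
`W = W(t) ≤ 1` is the generating function of the letters, and `P` and `m` are the length and the
degree of the word `w₀`, then `a tᵐ ≤ P b`. -/
theorem mul_pow_wordDeg_le {d : L → ℕ} {t a b : ℝ≥0∞} (hW : ∑' l, t ^ d l ≤ 1) (ha : a ≠ ⊤)
    (w₀ : List L)
    (h : a ≤ b * ∑' w : {w : List L // w.length < w₀.length}, t ^ wordDeg d w.1 +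
      a * ∑' w : {w : List L // w.length = w₀.length ∧ w ≠ w₀}, t ^ wordDeg d w.1) :
    a * t ^ wordDeg d w₀ ≤ b * w₀.length := by
  set R := ∑' w : {w : List L // w.length = w₀.length ∧ w ≠ w₀}, t ^ wordDeg d w.1
  have hR : R + t ^ wordDeg d w₀ ≤ 1 := by
    rw [tsum_word_length_ne_add]
    exact pow_le_one₀ zero_le hW
  have h1 : a + a * t ^ wordDeg d w₀ ≤ b * w₀.length + a := by
    calc a + a * t ^ wordDeg d w₀ ≤ (b * w₀.length + a * R) + a * t ^ wordDeg d w₀ := by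
          gcongr
          exact h.trans (by gcongr; exact tsum_word_length_lt_le d hW _)
      _ = b * w₀.length + a * (R + t ^ wordDeg d w₀) := by ring
      _ ≤ b * w₀.length + a * 1 := by gcongr
      _ = _ := by rw [mul_one]
  rw [add_comm a] at h1
  exact (ENNReal.add_le_add_iff_right ha).1 h1

end Words

/-! ### Normal words -/

section NormalWords

variable {k A β S : Type*} [Field k] [Ring A] [Algebra k A]

theorem mul_mem_of_mem_span_left {X : Set A} {N : Submodule k A} {x c : A}
    (hx : x ∈ Submodule.span k X) (h : ∀ y ∈ X, y * c ∈ N) : x * c ∈ N :=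
  (Submodule.span_le.2 h : Submodule.span k X ≤ N.comap (LinearMap.mulRight k c)) hx

theorem mul_mem_of_mem_span_right {X : Set A} {N : Submodule k A} {x c : A}
    (hx : x ∈ Submodule.span k X) (h : ∀ y ∈ X, c * y ∈ N) : c * x ∈ N :=
  (Submodule.span_le.2 h : Submodule.span k X ≤ N.comap (LinearMap.mulLeft k c)) hx

/-- The product `s₁ σ(b₁) ⋯ sₙ σ(bₙ)` of a word in the letters `(sᵢ, bᵢ)`. -/
def wordProd (s : S → A) (σ : β → A) (w : List (S × β)) : A :=
  (w.map fun l => s l.1 * σ l.2).prod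

@[simp] theorem wordProd_nil (s : S → A) (σ : β → A) : wordProd s σ [] = 1 := rfl

@[simp] theorem wordProd_cons (s : S → A) (σ : β → A) (l : S × β) (w : List (S × β)) :
    wordProd s σ (l :: w) = s l.1 * σ l.2 * wordProd s σ w := by simp [wordProd]

@[simp] theorem wordProd_append (s : S → A) (σ : β → A) (v w : List (S × β)) :
    wordProd s σ (v ++ w) = wordProd s σ v * wordProd s σ w := by simp [wordProd]

/-- The element `σ(b₀) s₁ σ(b₁) ⋯ sₙ σ(bₙ)` attached to `b₀` and a word in the letters
`(sᵢ, bᵢ)`. -/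
def normalWord (s : S → A) (σ : β → A) (x : β × List (S × β)) : A := σ x.1 * wordProd s σ x.2

/-- The degree of the letter `(s, b)`. -/
def letterDeg (dS : S → ℕ) (dβ : β → ℕ) (l : S × β) : ℕ := dS l.1 + dβ l.2

/-- The degree of a normal word. -/
def normalDeg (dS : S → ℕ) (dβ : β → ℕ) (x : β × List (S × β)) : ℕ :=
  dβ x.1 + wordDeg (letterDeg dS dβ) x.2

variable {𝒜 : ℕ → Submodule k A} {s : S → A} {σ : β → A} {dS : S → ℕ} {dβ : β → ℕ}

theorem wordProd_mem [GradedAlgebra 𝒜] (hs : ∀ i, s i ∈ 𝒜 (dS i)) (hσ : ∀ b, σ b ∈ 𝒜 (dβ b))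
    (w : List (S × β)) : wordProd s σ w ∈ 𝒜 (wordDeg (letterDeg dS dβ) w) := by
  induction w with
  | nil => exact SetLike.GradedOne.one_mem
  | cons l w ih =>
    rw [wordProd_cons, wordDeg_cons]
    exact SetLike.GradedMul.mul_mem (SetLike.GradedMul.mul_mem (hs _) (hσ _)) ih

/-- If `A` is spanned in each degree by the elements `σ b` and the elements of the ideal generated
by the `s i`, then it is spanned by the normal words. -/
theorem le_span_normalWord (hdS : ∀ i, 0 < dS i)
    (h : ∀ n, 𝒜 n ≤ Submodule.span k (σ '' {b | dβ b = n}) ⊔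
      Submodule.span k {x | ∃ i p q, ∃ a ∈ 𝒜 p, ∃ a' ∈ 𝒜 q, p + dS i + q = n ∧ x = a * s i * a'})
    (n : ℕ) :
    𝒜 n ≤ Submodule.span k (normalWord s σ '' {x | normalDeg dS dβ x = n}) := by
  induction n using Nat.strong_induction_on with
  | _ n ih =>
    refine (h n).trans (sup_le ?_ ?_)
    · refine Submodule.span_mono ?_
      rintro _ ⟨b, rfl, rfl⟩
      exact ⟨(b, []), by simp [normalDeg], by simp [normalWord]⟩
    · rw [Submodule.span_le]
      rintro _ ⟨i, p, q, a, ha, a', ha', rfl, rfl⟩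
      have hi := hdS i
      refine mul_mem_of_mem_span_right (ih q (by omega) ha') ?_
      rintro _ ⟨⟨b, w⟩, rfl, rfl⟩
      rw [mul_assoc]
      refine mul_mem_of_mem_span_left (ih p (by omega) ha) ?_
      rintro _ ⟨⟨b', w'⟩, rfl, rfl⟩
      refine Submodule.subset_span ⟨(b', w' ++ (i, b) :: w), ?_, ?_⟩
      · simp [normalDeg, letterDeg]; omega
      · simp [normalWord, mul_assoc]

/-- A linear relation between normal words of degree `m` expresses, after multiplication by a
generator on the left, the product of some word `w₀` through those of other words of the
same length and of longer words: `w₀` comes from a shortest word of the relation. -/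
theorem exists_wordProd_mem_span (i₀ : S) {m : ℕ}
    (h : ¬ LinearIndependent k fun x : {x : β × List (S × β) // normalDeg dS dβ x = m} =>
      normalWord s σ x.1) :
    ∃ w₀ : List (S × β), wordProd s σ w₀ ∈ Submodule.span k (wordProd s σ ''
      {w | wordDeg (letterDeg dS dβ) w = wordDeg (letterDeg dS dβ) w₀ ∧
        (w.length = w₀.length ∧ w ≠ w₀ ∨ w₀.length < w.length)}) := by
  classical
  rw [linearIndependent_iff'] at h
  push Not at h
  obtain ⟨t, g, hsum, i, hi, hgi⟩ := h
  obtain ⟨x, hx, hmin⟩ := Finset.exists_min_image (t.filter fun x => g x ≠ 0)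
    (fun x => x.1.2.length) ⟨i, by simp [hi, hgi]⟩
  rw [Finset.mem_filter] at hx
  let v : β × List (S × β) → List (S × β) := fun x => (i₀, x.1) :: x.2
  have hv : ∀ x, s i₀ * normalWord s σ x = wordProd s σ (v x) := fun x => by
    simp [v, normalWord, mul_assoc]
  have hvd : ∀ x, wordDeg (letterDeg dS dβ) (v x) = dS i₀ + normalDeg dS dβ x := fun x => by
    simp [v, normalDeg, letterDeg, add_assoc]
  refine ⟨v x.1, ?_⟩
  have hrel : g x • wordProd s σ (v x.1) = - ∑ y ∈ t.erase x, g y • wordProd s σ (v y.1) := by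
    rw [eq_neg_iff_add_eq_zero, Finset.add_sum_erase _ (fun y => g y • wordProd s σ (v y.1)) hx.1]
    have := congrArg (s i₀ * ·) hsum
    simpa only [Finset.mul_sum, mul_smul_comm, hv, mul_zero] using this
  -- minimality of `x` leaves words of the same length other than `v x`, and longer ones
  rw [← Submodule.smul_mem_iff _ hx.2, hrel]
  refine Submodule.neg_mem _ (Submodule.sum_mem _ fun y hy => ?_)
  by_cases hgy : g y = 0
  · simp [hgy]
  rw [Finset.mem_erase] at hy
  refine Submodule.smul_mem _ _ (Submodule.subset_span ⟨v y.1, ⟨?_, ?_⟩, rfl⟩)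
  · rw [hvd, hvd, x.2, y.2]
  · have hle := hmin y (by simp [hy.2, hgy])
    rcases hle.eq_or_lt with h1 | h1
    · refine Or.inl ⟨by simp [v, h1], fun h2 => hy.1 (Subtype.ext ?_)⟩
      simp only [v, List.cons.injEq, Prod.mk.injEq, true_and] at h2
      exact Prod.ext h2.1 h2.2
    · exact Or.inr (by simpa [v] using h1)

/-- If the product of `w₀` is expressed through other words of the same length and longer words,
then every `a s₁ σ(b₁) ⋯ sₙ σ(bₙ)` with at least `|w₀|` letters is a combination of
elements `a' ∏ w'` with `|w'| = |w₀|` and `w' ≠ w₀`: the last `|w₀|` letters can be rewritten,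
and as the degree is fixed, words cannot grow longer forever. -/
theorem mul_wordProd_mem_span [GradedAlgebra 𝒜] (hdS : ∀ i, 0 < dS i)
    (hs : ∀ i, s i ∈ 𝒜 (dS i)) (hσ : ∀ b, σ b ∈ 𝒜 (dβ b)) {w₀ : List (S × β)}
    (h : wordProd s σ w₀ ∈ Submodule.span k (wordProd s σ ''
      {w | wordDeg (letterDeg dS dβ) w = wordDeg (letterDeg dS dβ) w₀ ∧
        (w.length = w₀.length ∧ w ≠ w₀ ∨ w₀.length < w.length)}))
    {p : ℕ} {a : A} (ha : a ∈ 𝒜 p) (w : List (S × β)) (hw : w₀.length ≤ w.length) :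
    a * wordProd s σ w ∈ Submodule.span k {x | ∃ q, ∃ a' ∈ 𝒜 q, ∃ w' : List (S × β),
      (w'.length = w₀.length ∧ w' ≠ w₀) ∧
        q + wordDeg (letterDeg dS dβ) w' = p + wordDeg (letterDeg dS dβ) w ∧
        x = a' * wordProd s σ w'} := by
  have hlen : ∀ w : List (S × β), w.length ≤ wordDeg (letterDeg dS dβ) w :=
    length_le_wordDeg fun l => Nat.add_pos_left (hdS _) _
  induction hN : wordDeg (letterDeg dS dβ) w - w.length using Nat.strong_induction_on
    generalizing w with
  | _ N ih =>
    obtain ⟨w₁, w₂, rfl, hw₂⟩ : ∃ w₁ w₂, w = w₁ ++ w₂ ∧ w₂.length = w₀.length :=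
      ⟨w.take (w.length - w₀.length), w.drop (w.length - w₀.length), by simp, by simp; omega⟩
    by_cases hw0 : w₂ = w₀
    · -- rewrite the final `w₀`; the longer words that appear are covered by the induction
      subst hw0
      rw [wordProd_append, ← mul_assoc]
      refine mul_mem_of_mem_span_right h ?_
      rintro _ ⟨w', ⟨hd, hw' | hw'⟩, rfl⟩
      · exact Submodule.subset_span ⟨_, _, SetLike.GradedMul.mul_mem ha (wordProd_mem hs hσ w₁),
          w', hw', by simp [hd, add_assoc], rfl⟩
      · have hl := hlen (w₁ ++ w')
        have := ih _ (by simp at hl hN ⊢; omega) (w₁ ++ w') (by simp; omega) rfl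
        simpa [hd, mul_assoc] using this
    · rw [wordProd_append, ← mul_assoc]
      exact Submodule.subset_span ⟨_, _, SetLike.GradedMul.mul_mem ha (wordProd_mem hs hσ w₁),
          w₂, ⟨hw₂, hw0⟩, by simp [add_assoc], rfl⟩

/-- Given a relation on `w₀` as above, the component `𝒜 n` is spanned by the normal words with
fewer than `|w₀|` letters and the elements `a ∏ w'` with `a` in a homogeneous spanning family,
`|w'| = |w₀|` and `w' ≠ w₀`. -/
theorem le_span_of_wordProd_mem_span [GradedAlgebra 𝒜] (hdS : ∀ i, 0 < dS i)
    (hs : ∀ i, s i ∈ 𝒜 (dS i)) (hσ : ∀ b, σ b ∈ 𝒜 (dβ b)) {w₀ : List (S × β)}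
    (h : wordProd s σ w₀ ∈ Submodule.span k (wordProd s σ ''
      {w | wordDeg (letterDeg dS dβ) w = wordDeg (letterDeg dS dβ) w₀ ∧
        (w.length = w₀.length ∧ w ≠ w₀ ∨ w₀.length < w.length)}))
    (hspan : ∀ n, 𝒜 n ≤ Submodule.span k (normalWord s σ '' {x | normalDeg dS dβ x = n}))
    {α : Type*} {a : α → A} {dα : α → ℕ} (hα : ∀ n, 𝒜 n ≤ Submodule.span k (a '' {i | dα i = n}))
    (n : ℕ) :
    𝒜 n ≤ Submodule.span k
      (Sum.elim (fun x : β × {w : List (S × β) // w.length < w₀.length} =>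
            normalWord s σ (x.1, x.2.1))
          (fun x : α × {w : List (S × β) // w.length = w₀.length ∧ w ≠ w₀} =>
            a x.1 * wordProd s σ x.2.1) ''
        {y | Sum.elim (fun x => dβ x.1 + wordDeg (letterDeg dS dβ) x.2.1)
          (fun x => dα x.1 + wordDeg (letterDeg dS dβ) x.2.1) y = n}) := by
  refine (hspan n).trans (Submodule.span_le.2 ?_)
  rintro _ ⟨⟨b, w⟩, rfl, rfl⟩
  by_cases hw : w.length < w₀.length
  · exact Submodule.subset_span ⟨Sum.inl (b, ⟨w, hw⟩), rfl, rfl⟩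
  · refine (Submodule.span_le.2 ?_) (mul_wordProd_mem_span hdS hs hσ h (hσ b) w (not_lt.1 hw))
    rintro _ ⟨q, a', ha', w', hw', hq, rfl⟩
    refine mul_mem_of_mem_span_left (hα q ha') ?_
    rintro _ ⟨i, rfl, rfl⟩
    exact Submodule.subset_span ⟨Sum.inr (i, ⟨w', hw'⟩), hq, rfl⟩

/-- The generating function of the normal words factors. -/
theorem tsum_normalDeg (t : ℝ≥0∞) :
    ∑' x : β × List (S × β), t ^ normalDeg dS dβ x =
      (∑' b, t ^ dβ b) * ∑' w, t ^ wordDeg (letterDeg dS dβ) w := by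
  rw [ENNReal.tsum_prod', ← ENNReal.tsum_mul_right]
  refine tsum_congr fun b => ?_
  rw [← ENNReal.tsum_mul_left]
  simp [normalDeg, pow_add]

theorem tsum_mul_pow_le_tsum_letterDeg (i₀ : S) (t : ℝ≥0∞) :
    (∑' b, t ^ dβ b) * t ^ dS i₀ ≤ ∑' l, t ^ letterDeg dS dβ l := by
  rw [ENNReal.tsum_prod', mul_comm, ← ENNReal.tsum_mul_left]
  refine le_trans (le_of_eq (tsum_congr fun b => ?_)) (ENNReal.le_tsum i₀)
  simp [letterDeg, pow_add]

end NormalWords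

/-- The index set of a homogeneous basis; its generating function is the Hilbert series. -/
abbrev BasisIndex {k V : Type*} [Field k] [AddCommGroup V] [Module k V]
    (𝒱 : ℕ → Submodule k V) : Type := Σ n, Fin (Module.finrank k (𝒱 n))

section BasisIndex

variable {k V : Type*} [Field k] [AddCommGroup V] [Module k V] {𝒱 : ℕ → Submodule k V}

theorem tsum_basisIndex (g : ℕ → ℝ≥0∞) :
    ∑' i : BasisIndex 𝒱, g i.1 = ∑' n, (Module.finrank k (𝒱 n) : ℝ≥0∞) * g n := by
  rw [ENNReal.tsum_sigma']
  exact tsum_congr fun n => by simp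

theorem tsum_basisIndex_pow (t : ℝ≥0∞) :
    ∑' i : BasisIndex 𝒱, t ^ i.1 = valueAt (hilbertSeries 𝒱) t := by
  rw [tsum_basisIndex fun n => t ^ n]
  simp [valueAt, hilbertSeries]

theorem exists_homogeneous_spanning_family (h : ∀ n, FiniteDimensional k (𝒱 n)) :
    ∃ a : BasisIndex 𝒱 → V, ∀ n, 𝒱 n ≤ Submodule.span k (a '' {i | i.1 = n}) := by
  refine ⟨fun i => (Module.finBasis k (𝒱 i.1) i.2 : 𝒱 i.1), fun n x hx => ?_⟩
  have h1 := (Module.finBasis k (𝒱 n)).mem_span ⟨x, hx⟩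
  have h2 := Submodule.mem_map_of_mem (f := (𝒱 n).subtype) h1
  rw [Submodule.map_span] at h2
  refine Submodule.span_mono ?_ h2
  rintro _ ⟨_, ⟨j, rfl⟩, rfl⟩
  exact ⟨⟨n, j⟩, rfl, rfl⟩

end BasisIndex

/-! ### Normal words in the free product with a free algebra -/

section FreeProductBasis

universe u v w

variable {k : Type u} [Field k] {X : Type v} [Ring X] [Algebra k X] {S : Type w} {β : Type*}
  (b : Module.Basis β k X)

/-- The operator of the free generator `s` on `⊕_w X`, the sum over all words `w` in the
letters `S × β`: it moves a basis element `b i` in position `w` into the word, giving `1` in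
position `(s, i) w`. -/
noncomputable def generatorOp (s : S) : Module.End k (List (S × β) →₀ X) :=
  Finsupp.lsum k fun w =>
    Finsupp.linearCombination k (fun i => Finsupp.single ((s, i) :: w) (1 : X)) ∘ₗ
      b.repr.toLinearMap

theorem generatorOp_single (s : S) (w : List (S × β)) (i : β) :
    generatorOp b s (Finsupp.single w (b i)) = Finsupp.single ((s, i) :: w) 1 := by
  simp [generatorOp]

/-- The actions of the two factors `X` and `k⟨S⟩` on `⊕_w X`: the algebra `X` acts by left
multiplication in each position, the free generators by `generatorOp`. -/
noncomputable def factorRep :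
    ∀ i, Factor X (FreeAlgebra k S) i →ₐ[k] Module.End k (List (S × β) →₀ X)
  | false => (Algebra.lsmul k k (List (S × β) →₀ X)).comp
      (ULift.algEquiv (R := k) (A := X)).toAlgHom
  | true => (FreeAlgebra.lift k (generatorOp b)).comp
      (ULift.algEquiv (R := k) (A := FreeAlgebra k S)).toAlgHom

/-- The action of the free product of `X` and `k⟨S⟩` on `⊕_w X`. -/
noncomputable def wordRep :
    FreeProd k X (FreeAlgebra k S) →ₐ[k] Module.End k (List (S × β) →₀ X) :=
  LinearAlgebra.FreeProduct.lift k (Factor X (FreeAlgebra k S)) fun {i} => factorRep b i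

theorem wordRep_inl (x : X) (m : List (S × β) →₀ X) :
    wordRep b (inl k X (FreeAlgebra k S) x) m = x • m :=
  LinearMap.congr_fun (DFunLike.congr_fun (LinearAlgebra.FreeProduct.lift_comp_ι k
    (Factor X (FreeAlgebra k S)) (i := false) fun {i} => factorRep b i) (ULift.up x)) m

theorem wordRep_inr (s : S) (m : List (S × β) →₀ X) :
    wordRep b (inr k X (FreeAlgebra k S) (FreeAlgebra.ι k s)) m = generatorOp b s m := by
  refine (LinearMap.congr_fun (DFunLike.congr_fun (LinearAlgebra.FreeProduct.lift_comp_ι k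
    (Factor X (FreeAlgebra k S)) (i := true) fun {i} => factorRep b i)
    (ULift.up (FreeAlgebra.ι k s))) m).trans ?_
  change FreeAlgebra.lift k (generatorOp b) (FreeAlgebra.ι k s) m = _
  rw [FreeAlgebra.lift_ι_apply]

theorem wordRep_wordProd (w : List (S × β)) :
    wordRep b (wordProd (fun s => inr k X (FreeAlgebra k S) (FreeAlgebra.ι k s))
      (fun i => inl k X (FreeAlgebra k S) (b i)) w) (Finsupp.single [] 1) =
      Finsupp.single w 1 := by
  induction w with
  | nil => simp
  | cons l w ih =>
    rw [wordProd_cons, map_mul, map_mul, Module.End.mul_apply, Module.End.mul_apply, ih,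
      wordRep_inl, wordRep_inr, Finsupp.smul_single, smul_eq_mul, mul_one, generatorOp_single]

/-- The normal words `b₀ s₁ b₁ ⋯ sₙ bₙ` are linearly independent in the free product: applied to
`1` in the empty position they give `b₀` in position `w`, and these elements are independent. -/
theorem linearIndependent_normalWord :
    LinearIndependent k (normalWord (fun s : S => inr k X (FreeAlgebra k S) (FreeAlgebra.ι k s))
      (fun i => inl k X (FreeAlgebra k S) (b i))) := by
  have h1 : LinearIndependent k fun x : β × List (S × β) => Finsupp.single x.2 (b x.1) := by
    have h := Finsupp.linearIndependent_single (R := k) (fun (_ : List (S × β)) => b)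
      (fun _ => b.linearIndependent)
    exact h.comp (fun x : β × List (S × β) => (⟨x.2, x.1⟩ : Σ _ : List (S × β), β))
      fun x y hxy => by simp only [Sigma.mk.injEq, heq_eq_eq] at hxy; exact Prod.ext hxy.2 hxy.1
  refine LinearIndependent.of_comp
    ((LinearMap.applyₗ (R := k) (Finsupp.single [] (1 : X))) ∘ₗ (wordRep b).toLinearMap) ?_
  convert! h1 using 1
  funext x
  simp [normalWord, wordRep_inl, wordRep_wordProd]

variable {b} {𝒳 : ℕ → Submodule k X} {dβ : β → ℕ} {deg : S → ℕ}

/-- The normal words of degree `n` span the component of degree `n` of the free product. -/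
theorem freeProdGrading_eq_span (hb : ∀ i, b i ∈ 𝒳 (dβ i))
    (hspan : ∀ n, 𝒳 n ≤ Submodule.span k (b '' {i | dβ i = n})) (hone : 1 ∈ 𝒳 0)
    (hmul : ∀ {p q x y}, x ∈ 𝒳 p → y ∈ 𝒳 q → x * y ∈ 𝒳 (p + q)) (n : ℕ) :
    freeProdGrading 𝒳 (freeGrading k deg) n = Submodule.span k
      (normalWord (fun s : S => inr k X (FreeAlgebra k S) (FreeAlgebra.ι k s))
        (fun i => inl k X (FreeAlgebra k S) (b i)) '' {x | normalDeg deg dβ x = n}) := by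
  set s' := fun s : S => inr k X (FreeAlgebra k S) (FreeAlgebra.ι k s)
  set b' := fun i => inl k X (FreeAlgebra k S) (b i)
  apply le_antisymm
  · have h0 : ∀ {d x} (w : List (S × β)), x ∈ 𝒳 d → inl k X (FreeAlgebra k S) x * wordProd s' b' w ∈
        Submodule.span k (normalWord s' b' '' {x | normalDeg deg dβ x =
          d + wordDeg (letterDeg deg dβ) w}) := by
      intro d x w hx
      have h1 := Submodule.mem_map_of_mem (f := (inl k X (FreeAlgebra k S)).toLinearMap)
        (hspan d hx)
      rw [Submodule.map_span] at h1
      refine mul_mem_of_mem_span_left h1 ?_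
      rintro _ ⟨_, ⟨i, rfl, rfl⟩, rfl⟩
      exact Submodule.subset_span ⟨(i, w), rfl, rfl⟩
    have hX : ∀ {d n x c}, x ∈ 𝒳 d → c ∈ Submodule.span k (normalWord s' b' ''
        {x | normalDeg deg dβ x = n}) → inl k X (FreeAlgebra k S) x * c ∈
          Submodule.span k (normalWord s' b' '' {x | normalDeg deg dβ x = d + n}) := by
      intro d n x c hx hc
      refine mul_mem_of_mem_span_right hc ?_
      rintro _ ⟨⟨i, w⟩, rfl, rfl⟩
      have := h0 w (hmul hx (hb i))
      simpa [normalWord, normalDeg, b', mul_assoc, add_assoc] using this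
    have hS : ∀ {n c} (s : S), c ∈ Submodule.span k (normalWord s' b' ''
        {x | normalDeg deg dβ x = n}) → s' s * c ∈
          Submodule.span k (normalWord s' b' '' {x | normalDeg deg dβ x = deg s + n}) := by
      intro n c s hc
      refine mul_mem_of_mem_span_right hc ?_
      rintro _ ⟨⟨i, w⟩, rfl, rfl⟩
      have := h0 ((s, i) :: w) hone
      simpa [normalWord, normalDeg, letterDeg, mul_assoc, add_assoc] using this
    refine Submodule.span_le.2 ?_
    intro c hc
    induction hc with
    | one => simpa using h0 [] hone
    | inl_mul hx _ ih => exact hX hx ih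
    | @inr_mul d n y c hy _ ih =>
      have h1 := Submodule.mem_map_of_mem (f := (inr k X (FreeAlgebra k S)).toLinearMap) hy
      rw [freeGrading, Submodule.map_span] at h1
      refine mul_mem_of_mem_span_left h1 ?_
      rintro _ ⟨_, ⟨l, rfl, rfl⟩, rfl⟩
      clear h1 hy
      induction l with
      | nil => simpa using ih
      | cons s l ihl =>
        have := hS s ihl
        simpa [s', mul_assoc, add_assoc] using this
  · refine Submodule.span_mono ?_
    rintro _ ⟨⟨i, w⟩, rfl, rfl⟩
    refine IsWord.inl_mul (hb i) ?_
    induction w with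
    | nil => exact IsWord.one
    | cons l w ih =>
      rw [wordProd_cons, wordDeg_cons, letterDeg, add_assoc, mul_assoc]
      exact IsWord.inr_mul (Submodule.subset_span ⟨[l.1], by simp, by simp⟩)
        (IsWord.inl_mul (hb l.2) ih)

end FreeProductBasis

/-! ### Hilbert series of finitely generated algebras -/

section FiniteType

open scoped NNReal
open Filter Topology

variable {k A : Type*} [Field k] [Ring A] [Algebra k A] {𝒜 : ℕ → Submodule k A}

/-- In a finitely generated connected graded algebra, with generators of degree at most `D`, an
element of degree `> D` is a sum of products with a left factor of degree between `1` and `D`. -/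
theorem exists_le_span_mul [GradedAlgebra 𝒜] (hconn : IsConnectedGrading 𝒜)
    (hft : Algebra.FiniteType k A) :
    ∃ D, ∀ N, D < N → 𝒜 N ≤ Submodule.span k
      {x | ∃ i j, 1 ≤ i ∧ i ≤ D ∧ i + j = N ∧ ∃ a ∈ 𝒜 i, ∃ a' ∈ 𝒜 j, x = a * a'} := by
  classical
  obtain ⟨G, hG⟩ := hft.out
  let D := G.sup fun g => (DirectSum.decompose 𝒜 g).support.sup id
  let G' : Set A := {x | ∃ i ≤ D, x ∈ 𝒜 i}
  have hG' : Algebra.adjoin k G' = ⊤ := by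
    rw [← top_le_iff, ← hG]
    refine Algebra.adjoin_le fun g hg => ?_
    rw [← DirectSum.sum_support_decompose 𝒜 g]
    refine Subalgebra.sum_mem _ fun i hi => Algebra.subset_adjoin ⟨i, ?_, SetLike.coe_mem _⟩
    exact (Finset.le_sup (f := id) hi).trans
      (Finset.le_sup (f := fun g => (DirectSum.decompose 𝒜 g).support.sup id) hg)
  refine ⟨D, ?_⟩
  -- `P N` is the span in the claim; `G'` consists of all homogeneous elements of degree `≤ D`.
  set P : ℕ → Submodule k A := fun N => Submodule.span k
      {x | ∃ i j, 1 ≤ i ∧ i ≤ D ∧ i + j = N ∧ ∃ a ∈ 𝒜 i, ∃ a' ∈ 𝒜 j, x = a * a'}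
  have hcl : ∀ x ∈ Submonoid.closure G', ∃ n, x ∈ 𝒜 n ∧ (D < n → x ∈ P n) := by
    intro x hx
    induction hx using Submonoid.closure_induction with
    | mem x hx =>
      obtain ⟨i, hi, hx⟩ := hx
      exact ⟨i, hx, fun h => absurd hi (not_le.2 h)⟩
    | one => exact ⟨0, SetLike.GradedOne.one_mem, fun h => absurd h (Nat.not_lt_zero _)⟩
    | mul x y _ _ ihx ihy =>
      obtain ⟨n, hxn, hn⟩ := ihx
      obtain ⟨m, hym, hm⟩ := ihy
      refine ⟨n + m, SetLike.GradedMul.mul_mem hxn hym, fun hD => ?_⟩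
      rcases Nat.eq_zero_or_pos n with rfl | hn0
      · rw [hconn.zero_eq] at hxn
        obtain ⟨c, rfl⟩ := hxn
        rw [zero_add] at hD ⊢
        rw [Algebra.linearMap_apply, ← Algebra.smul_def]
        exact Submodule.smul_mem _ _ (hm hD)
      · by_cases hnD : n ≤ D
        · exact Submodule.subset_span ⟨n, m, hn0, hnD, rfl, x, hxn, y, hym, rfl⟩
        · refine mul_mem_of_mem_span_left (hn (not_le.1 hnD)) ?_
          rintro _ ⟨i, j, hi, hiD, rfl, a, ha, a', ha', rfl⟩
          exact Submodule.subset_span ⟨i, j + m, hi, hiD, by omega, a, ha, a' * y,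
            SetLike.GradedMul.mul_mem ha' hym, mul_assoc _ _ _⟩
  intro N hN a ha
  have h1 : a ∈ Submodule.span k (Submonoid.closure G' : Set A) := by
    rw [← Algebra.adjoin_eq_span, hG']
    exact Submodule.mem_top
  have h2 := Submodule.mem_map_of_mem (f := GradedAlgebra.proj 𝒜 N) h1
  rw [GradedAlgebra.proj_apply, DirectSum.decompose_of_mem_same _ ha, Submodule.map_span] at h2
  refine (Submodule.span_le.2 ?_ : _ ≤ P N) h2
  rintro _ ⟨x, hx, rfl⟩
  obtain ⟨n, hxn, hn⟩ := hcl x hx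
  rw [GradedAlgebra.proj_apply]
  by_cases hnN : n = N
  · subst hnN
    rw [DirectSum.decompose_of_mem_same _ hxn]
    exact hn hN
  · rw [DirectSum.decompose_of_mem_ne _ hxn hnN]
    exact Submodule.zero_mem _

/-- A component of large degree is spanned by products whose left factor has its degree in a
prescribed interval of length `D + 1`: starting from `1 · a`, a left factor of too small a degree
`m` absorbs the left factor, of degree between `1` and `D`, of its cofactor. -/
theorem le_span_mul_of_le [GradedAlgebra 𝒜] {D : ℕ}
    (hD : ∀ N, D < N → 𝒜 N ≤ Submodule.span k
      {x | ∃ i j, 1 ≤ i ∧ i ≤ D ∧ i + j = N ∧ ∃ a ∈ 𝒜 i, ∃ a' ∈ 𝒜 j, x = a * a'})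
    (m N : ℕ) (hN : m + (D + 1) ≤ N) : 𝒜 N ≤ Submodule.span k
      {x | ∃ i j, m ≤ i ∧ i < m + (D + 1) ∧ i + j = N ∧ ∃ a ∈ 𝒜 i, ∃ a' ∈ 𝒜 j, x = a * a'} := by
  induction m with
  | zero =>
    exact fun a ha => Submodule.subset_span ⟨0, N, le_rfl, by omega, by omega, 1,
      SetLike.GradedOne.one_mem, a, ha, (one_mul a).symm⟩
  | succ m ih =>
    refine (ih (by omega)).trans (Submodule.span_le.2 ?_)
    rintro _ ⟨i, j, hi, hi', hij, a, ha, a', ha', rfl⟩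
    rcases hi.eq_or_lt with rfl | hi
    · refine mul_mem_of_mem_span_right (hD j (by omega) ha') ?_
      rintro _ ⟨i₁, j₁, h1, h1D, rfl, a₁, ha₁, a₂, ha₂, rfl⟩
      exact Submodule.subset_span ⟨m + i₁, j₁, by omega, by omega, by omega, a * a₁,
        SetLike.GradedMul.mul_mem ha ha₁, a₂, ha₂, (mul_assoc _ _ _).symm⟩
    · exact Submodule.subset_span ⟨i, j, hi, by omega, hij, a, ha, a', ha', rfl⟩

/-- Numerical form of `le_span_mul_of_le`, for the Hilbert series truncated at degree `K`. -/
theorem sum_finrank_mul_pow_le (hfin : ∀ n, FiniteDimensional k (𝒜 n)) {m D : ℕ}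
    (h : ∀ N, m + D ≤ N → 𝒜 N ≤ Submodule.span k
      {x | ∃ i j, m ≤ i ∧ i < m + D ∧ i + j = N ∧ ∃ a ∈ 𝒜 i, ∃ a' ∈ 𝒜 j, x = a * a'})
    (t : ℝ≥0∞) (K : ℕ) :
    ∑ n ∈ Finset.range K, (Module.finrank k (𝒜 n) : ℝ≥0∞) * t ^ n ≤
      ∑ n ∈ Finset.range (m + D), (Module.finrank k (𝒜 n) : ℝ≥0∞) * t ^ n +
      (∑ n ∈ Finset.Ico m (m + D), (Module.finrank k (𝒜 n) : ℝ≥0∞) * t ^ n) *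
        ∑ n ∈ Finset.range K, (Module.finrank k (𝒜 n) : ℝ≥0∞) * t ^ n := by
  classical
  have hsum : ∀ s : Finset ℕ, ∑ n ∈ s, (Module.finrank k (𝒜 n) : ℝ≥0∞) * t ^ n =
      ∑' i : BasisIndex 𝒜, if i.1 ∈ s then t ^ i.1 else 0 := by
    intro s
    rw [tsum_basisIndex (fun n => if n ∈ s then t ^ n else 0), tsum_eq_sum (s := s)]
    · exact Finset.sum_congr rfl fun n hn => by simp [hn]
    · intro n hn; simp [hn]
  have hsub : ∀ s : Finset ℕ, ∑' i : {i : BasisIndex 𝒜 // i.1 ∈ s}, t ^ i.1.1 =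
      ∑ n ∈ s, (Module.finrank k (𝒜 n) : ℝ≥0∞) * t ^ n := by
    intro s
    rw [hsum]
    exact (tsum_subtype {i : BasisIndex 𝒜 | i.1 ∈ s} fun i => t ^ i.1).trans
      (tsum_congr fun i => by simp [Set.indicator])
  obtain ⟨a, hspan⟩ := exists_homogeneous_spanning_family hfin
  let Y := {i : BasisIndex 𝒜 // i.1 ∈ Finset.range (m + D)} ⊕
    {i : BasisIndex 𝒜 // i.1 ∈ Finset.Ico m (m + D)} × BasisIndex 𝒜
  let d : Y → ℕ := Sum.elim (fun i => i.1.1) fun p => p.1.1.1 + p.2.1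
  let f : Y → A := Sum.elim (fun i => a i.1) fun p => a p.1.1 * a p.2
  have hY : ∀ n, 𝒜 n ≤ Submodule.span k (f '' {y | d y = n}) := by
    intro n
    by_cases hn : n < m + D
    · refine (hspan n).trans (Submodule.span_mono ?_)
      rintro _ ⟨i, rfl, rfl⟩
      exact ⟨Sum.inl ⟨i, Finset.mem_range.2 hn⟩, rfl, rfl⟩
    · refine (h n (not_lt.1 hn)).trans (Submodule.span_le.2 ?_)
      rintro _ ⟨i, j, hi, hi', rfl, x, hx, x', hx', rfl⟩
      refine mul_mem_of_mem_span_left (hspan i hx) ?_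
      rintro _ ⟨p, rfl, rfl⟩
      refine mul_mem_of_mem_span_right (hspan j hx') ?_
      rintro _ ⟨q, rfl, rfl⟩
      exact Submodule.subset_span ⟨Sum.inr (⟨p, Finset.mem_Ico.2 ⟨hi, hi'⟩⟩, q), rfl, rfl⟩
  have := tsum_finrank_mul_le hY fun n => if n ∈ Finset.range K then t ^ n else 0
  rw [← tsum_basisIndex, ← hsum, ENNReal.summable.tsum_sum ENNReal.summable] at this
  refine this.trans (add_le_add ?_ ?_)
  · rw [← hsub]
    refine ENNReal.tsum_le_tsum fun i => ?_
    simp only [d, Sum.elim_inl, Finset.mem_range]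
    split_ifs <;> simp
  · rw [ENNReal.tsum_prod', ← hsub, ← ENNReal.tsum_mul_right]
    refine ENNReal.tsum_le_tsum fun i => ?_
    rw [hsum, ← ENNReal.tsum_mul_left]
    refine ENNReal.tsum_le_tsum fun j => ?_
    simp only [d, Sum.elim_inr, Finset.mem_range]
    split_ifs with h1 h2
    · rw [pow_add]
    · omega
    · simp
    · simp

/-- The Hilbert series of a finitely generated algebra diverges at its radius of convergence `r`:
if `A(r)` is finite, then in `A(t) ≤ Q(t) + ε(t) A(t)` the coefficient `ε`, a segment of the series
of bounded length, is small at `r` when it lies far out, hence also slightly beyond `r`, and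
the truncations of `A(t)` stay bounded there. -/
theorem valueAt_radius_eq_top_of_finiteType [GradedAlgebra 𝒜]
    (hconn : IsConnectedGrading 𝒜) (hft : Algebra.FiniteType k A)
    (hr : radius (hilbertSeries 𝒜) ≠ ⊤) :
    valueAt (hilbertSeries 𝒜) (radius (hilbertSeries 𝒜)) = ⊤ := by
  by_contra hfinite
  obtain ⟨r, hr'⟩ : ∃ r : ℝ≥0, (r : ℝ≥0∞) = radius (hilbertSeries 𝒜) :=
    ⟨_, ENNReal.coe_toNNReal hr⟩
  rw [← hr'] at hfinite
  obtain ⟨D, hD⟩ := exists_le_span_mul hconn hft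
  let u : ℝ≥0 → ℕ → ℝ≥0 := fun t n => (Module.finrank k (𝒜 n) : ℝ≥0) * t ^ n
  have hval : ∀ t : ℝ≥0, valueAt (hilbertSeries 𝒜) t = ∑' n, (u t n : ℝ≥0∞) := fun t => by
    simp [valueAt, hilbertSeries, u]
  rw [hval] at hfinite
  obtain ⟨m, hm⟩ : ∃ m, ∑ n ∈ Finset.Ico m (m + (D + 1)), u r n < 1 / 2 := by
    have htail := ENNReal.tendsto_sum_nat_add _ hfinite
    obtain ⟨m, hm⟩ := (htail.eventually (gt_mem_nhds (b := 0) (a := ((1 / 2 : ℝ≥0) : ℝ≥0∞))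
      (by simp))).exists
    refine ⟨m, ENNReal.coe_lt_coe.1 (lt_of_le_of_lt ?_ hm)⟩
    rw [Finset.sum_Ico_eq_sum_range, ENNReal.ofNNReal_finsetSum]
    simp only [add_comm m]
    exact ENNReal.sum_le_tsum _
  obtain ⟨t, ht, hrt⟩ : ∃ t, ∑ n ∈ Finset.Ico m (m + (D + 1)), u t n < 1 / 2 ∧ r < t := by
    have hc : Continuous fun t => ∑ n ∈ Finset.Ico m (m + (D + 1)), u t n := by fun_prop
    have h1 : ∀ᶠ t in 𝓝[>] r, ∑ n ∈ Finset.Ico m (m + (D + 1)), u t n < 1 / 2 :=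
      ((hc.tendsto r).eventually (gt_mem_nhds hm)).filter_mono nhdsWithin_le_nhds
    exact (h1.and self_mem_nhdsWithin).exists
  refine absurd (le_radius_of_valueAt_ne_top (f := hilbertSeries 𝒜) (t := t) ?_) ?_
  · set Q := ∑ n ∈ Finset.range (m + (D + 1)), u t n
    refine ne_top_of_le_ne_top (ENNReal.coe_ne_top (r := 2 * Q)) ?_
    rw [hval, ENNReal.tsum_eq_iSup_nat]
    refine iSup_le fun K => ?_
    have hK := sum_finrank_mul_pow_le hconn.finite
      (fun N hN => le_span_mul_of_le hD m N hN) (t : ℝ≥0∞) K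
    have hK' : ∑ n ∈ Finset.range K, u t n ≤
        Q + (∑ n ∈ Finset.Ico m (m + (D + 1)), u t n) * ∑ n ∈ Finset.range K, u t n := by
      rw [← ENNReal.coe_le_coe]
      push_cast [u, Q]
      exact_mod_cast hK
    rw [← ENNReal.ofNNReal_finsetSum, ENNReal.coe_le_coe]
    have h3 : ∑ n ∈ Finset.range K, u t n ≤ Q + 1 / 2 * ∑ n ∈ Finset.range K, u t n :=
      hK'.trans (by gcongr)
    rw [← NNReal.coe_le_coe] at h3 ⊢
    push_cast at h3 ⊢
    linarith
  · rw [← hr', not_le]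
    exact_mod_cast hrt

end FiniteType

/-! ### The quotient by a homogeneous ideal -/

section Quotient

variable {k A : Type*} [Field k] [Ring A] [Algebra k A] {𝒜 : ℕ → Submodule k A}

theorem mkₐ_eq_iff {I : TwoSidedIdeal A} {x y : A} :
    RingCon.mkₐ k I.ringCon x = RingCon.mkₐ k I.ringCon y ↔ x - y ∈ I := by
  rw [← TwoSidedIdeal.rel_iff]
  exact RingCon.eq _

theorem mkₐ_eq_zero_iff {I : TwoSidedIdeal A} {x : A} :
    RingCon.mkₐ k I.ringCon x = 0 ↔ x ∈ I := by
  rw [← map_zero (RingCon.mkₐ k I.ringCon), mkₐ_eq_iff, sub_zero]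

variable [GradedAlgebra 𝒜] {S : Set A} {deg : S → ℕ}

/-- The homogeneous components of an element of the ideal generated by homogeneous elements `s`
are sums of products `a s a'` with homogeneous `a` and `a'`. -/
theorem proj_mem_of_mem_span (hS : ∀ s : S, (s : A) ∈ 𝒜 (deg s)) {x : A}
    (hx : x ∈ TwoSidedIdeal.span S) (n : ℕ) :
    GradedAlgebra.proj 𝒜 n x ∈ Submodule.span k {x | ∃ i : S, ∃ p q, ∃ a ∈ 𝒜 p, ∃ a' ∈ 𝒜 q,
      p + deg i + q = n ∧ x = a * i * a'} := by
  set R := Submodule.span k {x | ∃ i : S, ∃ p q, ∃ a ∈ 𝒜 p, ∃ a' ∈ 𝒜 q,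
      p + deg i + q = n ∧ x = a * i * a'}
  rw [TwoSidedIdeal.mem_span_iff_mem_addSubgroup_closure] at hx
  induction hx using AddSubgroup.closure_induction with
  | mem x hx =>
    obtain ⟨_, ⟨a, -, s, hs, rfl⟩, a', -, rfl⟩ := hx
    change GradedAlgebra.proj 𝒜 n (a * s * a') ∈ R
    induction a using DirectSum.Decomposition.inductionOn 𝒜 with
    | zero => simp
    | add a₁ a₂ h₁ h₂ => rw [add_mul, add_mul, map_add]; exact add_mem h₁ h₂
    | @homogeneous p a =>
      induction a' using DirectSum.Decomposition.inductionOn 𝒜 with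
      | zero => simp
      | add a₁ a₂ h₁ h₂ => rw [mul_add, map_add]; exact add_mem h₁ h₂
      | @homogeneous q a' =>
        have hmem : (a : A) * s * a' ∈ 𝒜 (p + deg ⟨s, hs⟩ + q) :=
          SetLike.GradedMul.mul_mem (SetLike.GradedMul.mul_mem a.2 (hS ⟨s, hs⟩)) a'.2
        rw [GradedAlgebra.proj_apply]
        by_cases hn : p + deg ⟨s, hs⟩ + q = n
        · subst hn
          rw [DirectSum.decompose_of_mem_same _ hmem]
          exact Submodule.subset_span ⟨⟨s, hs⟩, p, q, a, a.2, a', a'.2, rfl, rfl⟩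
        · rw [DirectSum.decompose_of_mem_ne _ hmem hn]
          exact Submodule.zero_mem _
  | zero => simp
  | add x y _ _ hx hy => rw [map_add]; exact add_mem hx hy
  | neg x _ hx => rw [map_neg]; exact neg_mem hx

theorem proj_mem_span (hS : ∀ s : S, (s : A) ∈ 𝒜 (deg s)) {x : A}
    (hx : x ∈ TwoSidedIdeal.span S) (n : ℕ) :
    GradedAlgebra.proj 𝒜 n x ∈ TwoSidedIdeal.span S := by
  rw [← mkₐ_eq_zero_iff (k := k)]
  refine (Submodule.span_le.2 ?_ : _ ≤ LinearMap.ker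
    (RingCon.mkₐ k (TwoSidedIdeal.span S).ringCon).toLinearMap) (proj_mem_of_mem_span hS hx n)
  rintro _ ⟨i, p, q, a, -, a', -, -, rfl⟩
  exact (mkₐ_eq_zero_iff (k := k)).2 (TwoSidedIdeal.mul_mem_right _ _ _
    (TwoSidedIdeal.mul_mem_left _ _ _ (TwoSidedIdeal.subset_span i.2)))

/-- The images of the components grade the quotient by an ideal with homogeneous generators. -/
theorem isInternal_quotientGrading (hS : ∀ s : S, (s : A) ∈ 𝒜 (deg s)) :
    DirectSum.IsInternal (quotientGrading 𝒜 (TwoSidedIdeal.span S)) := by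
  classical
  set π := RingCon.mkₐ k (TwoSidedIdeal.span S).ringCon
  refine ⟨(injective_iff_map_eq_zero _).2 fun x hx => ?_, fun y => ?_⟩
  · -- lift the components `x n` of a relation to `a n ∈ 𝒜 n`; their sum is in the ideal, so
    -- each `a n`, being a component of the sum, is
    have hlift : ∀ n, ∃ a ∈ 𝒜 n, π a = x n := fun n => (x n).2
    choose a ha hax using hlift
    rw [DirectSum.coeAddMonoidHom_eq_dfinsuppSum, DFinsupp.sum] at hx
    have hmem : ∑ n ∈ x.support, a n ∈ TwoSidedIdeal.span S := by
      rw [← mkₐ_eq_zero_iff (k := k), map_sum, ← hx]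
      exact Finset.sum_congr rfl fun n _ => hax n
    refine DFinsupp.ext fun n => ?_
    by_contra hn
    refine hn (Subtype.ext ?_)
    have hproj := proj_mem_span hS hmem n
    rw [map_sum, Finset.sum_eq_single n] at hproj
    · rw [GradedAlgebra.proj_apply, DirectSum.decompose_of_mem_same _ (ha n),
        ← mkₐ_eq_zero_iff (k := k)] at hproj
      exact (hax n).symm.trans hproj
    · intro m _ hm
      rw [GradedAlgebra.proj_apply, DirectSum.decompose_of_mem_ne _ (ha m) hm]
    · intro h
      exact absurd (DFinsupp.notMem_support_iff.1 h) hn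
  · obtain ⟨x, rfl⟩ := RingCon.mkₐ_surjective (α := k) _ y
    induction x using DirectSum.Decomposition.inductionOn 𝒜 with
    | zero => exact ⟨0, by simp⟩
    | add a₁ a₂ h₁ h₂ =>
      obtain ⟨y₁, hy₁⟩ := h₁
      obtain ⟨y₂, hy₂⟩ := h₂
      exact ⟨y₁ + y₂, by rw [map_add, map_add, hy₁, hy₂]⟩
    | @homogeneous n a =>
      refine ⟨DirectSum.of (fun n => quotientGrading 𝒜 (TwoSidedIdeal.span S) n) n
        ⟨π a, Submodule.mem_map_of_mem a.2⟩, ?_⟩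
      rw [DirectSum.coeAddMonoidHom_of]

theorem mul_mem_quotientGrading {I : TwoSidedIdeal A} {p q : ℕ} {x y : QuotientAlgebra I}
    (hx : x ∈ quotientGrading 𝒜 I p) (hy : y ∈ quotientGrading 𝒜 I q) :
    x * y ∈ quotientGrading 𝒜 I (p + q) := by
  obtain ⟨a, ha, rfl⟩ := hx
  obtain ⟨b, hb, rfl⟩ := hy
  exact ⟨a * b, SetLike.GradedMul.mul_mem ha hb, map_mul (RingCon.mkₐ k I.ringCon) a b⟩

theorem one_mem_quotientGrading {I : TwoSidedIdeal A} :
    (1 : QuotientAlgebra I) ∈ quotientGrading 𝒜 I 0 :=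
  ⟨1, SetLike.GradedOne.one_mem, map_one (RingCon.mkₐ k I.ringCon)⟩

/-- A homogeneous basis of `A / I` for the ideal `I` generated by `S`, lifted to homogeneous
elements `σ i` of `A`; these span `A` modulo `I` in each degree. -/
theorem exists_quotient_basis (hfin : ∀ n, FiniteDimensional k (𝒜 n))
    (hS : ∀ s : S, (s : A) ∈ 𝒜 (deg s)) :
    ∃ (b : Module.Basis (BasisIndex (quotientGrading 𝒜 (TwoSidedIdeal.span S))) k
        (QuotientAlgebra (TwoSidedIdeal.span S)))
      (σ : BasisIndex (quotientGrading 𝒜 (TwoSidedIdeal.span S)) → A),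
      (∀ i, b i ∈ quotientGrading 𝒜 (TwoSidedIdeal.span S) i.1) ∧
      (∀ n, quotientGrading 𝒜 (TwoSidedIdeal.span S) n ≤
        Submodule.span k (b '' {i | i.1 = n})) ∧
      (∀ i, σ i ∈ 𝒜 i.1) ∧
      ∀ n, 𝒜 n ≤ Submodule.span k (σ '' {i | i.1 = n}) ⊔
        Submodule.span k {x | ∃ i : S, ∃ p q, ∃ a ∈ 𝒜 p, ∃ a' ∈ 𝒜 q,
          p + deg i + q = n ∧ x = a * i * a'} := by
  set I := TwoSidedIdeal.span S
  have hfinQ : ∀ n, FiniteDimensional k (quotientGrading 𝒜 I n) := fun n =>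
    have := hfin n
    Module.Finite.map (𝒜 n) _
  let v := fun n => Module.finBasis k (quotientGrading 𝒜 I n)
  let b := (isInternal_quotientGrading hS).collectedBasis v
  have hb : ∀ i, b i ∈ quotientGrading 𝒜 I i.1 :=
    (isInternal_quotientGrading hS).collectedBasis_mem v
  have hspan : ∀ n, quotientGrading 𝒜 I n ≤ Submodule.span k (b '' {i | i.1 = n}) := by
    intro n x hx
    have h2 := Submodule.mem_map_of_mem (f := (quotientGrading 𝒜 I n).subtype)
      ((v n).mem_span ⟨x, hx⟩)
    rw [Submodule.map_span] at h2
    refine Submodule.span_mono ?_ h2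
    rintro _ ⟨_, ⟨j, rfl⟩, rfl⟩
    exact ⟨⟨n, j⟩, rfl, by simp [b, DirectSum.IsInternal.collectedBasis_coe]⟩
  have hlift : ∀ i, ∃ a ∈ 𝒜 i.1, RingCon.mkₐ k I.ringCon a = b i := fun i => hb i
  choose σ hσ hσb using hlift
  refine ⟨b, σ, hb, hspan, hσ, fun n x hx => ?_⟩
  obtain ⟨y, hy, hxy⟩ : ∃ y ∈ Submodule.span k (σ '' {i | i.1 = n}),
      RingCon.mkₐ k I.ringCon y = RingCon.mkₐ k I.ringCon x := by
    have h1 := hspan n (Submodule.mem_map_of_mem hx)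
    rw [show (b '' {i | i.1 = n}) = (RingCon.mkₐ k I.ringCon).toLinearMap '' (σ '' {i | i.1 = n}) by
      rw [Set.image_image]
      exact Set.image_congr fun i _ => (hσb i).symm, ← Submodule.map_span] at h1
    exact h1
  have hyn : y ∈ 𝒜 n := by
    refine Submodule.span_le.2 ?_ hy
    rintro _ ⟨i, rfl, rfl⟩
    exact hσ i
  have h3 := proj_mem_of_mem_span hS (mkₐ_eq_iff.1 hxy.symm) n
  rw [GradedAlgebra.proj_apply, DirectSum.decompose_of_mem_same _ (sub_mem hx hyn)] at h3
  rw [← add_sub_cancel y x]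
  exact add_mem (Submodule.mem_sup_left hy) (Submodule.mem_sup_right h3)

end Quotient

/-! ### Finiteness of the set of normal words of a given degree -/

section Finiteness

theorem finite_le_of_finite_eq {ι : Type*} {d : ι → ℕ} (h : ∀ m, {i | d i = m}.Finite) (n : ℕ) :
    {i | d i ≤ n}.Finite :=
  (Set.finite_Iic n).preimage' fun m _ => h m

theorem finite_normalDeg_eq {β S : Type*} {dS : S → ℕ} {dβ : β → ℕ} (hdS : ∀ i, 0 < dS i)
    (hS : ∀ n, {i | dS i ≤ n}.Finite) (hβ : ∀ n, {b | dβ b ≤ n}.Finite) (n : ℕ) :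
    {x : β × List (S × β) | normalDeg dS dβ x = n}.Finite := by
  have hL : {l : S × β | letterDeg dS dβ l ≤ n}.Finite := by
    refine ((hS n).prod (hβ n)).subset fun l hl => ?_
    have : dS l.1 + dβ l.2 ≤ n := hl
    exact ⟨show dS l.1 ≤ n by omega, show dβ l.2 ≤ n by omega⟩
  refine ((hβ n).prod (finite_wordDeg_le (fun l => Nat.add_pos_left (hdS _) _) n hL)).subset
    fun x hx => ?_
  have : dβ x.1 + wordDeg (letterDeg dS dβ) x.2 = n := hx
  exact ⟨show dβ x.1 ≤ n by omega, show wordDeg (letterDeg dS dβ) x.2 ≤ n by omega⟩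

variable {k A : Type*} [Field k] [Ring A] [Algebra k A]

/-- A linear combination of other generators is a redundant generator. -/
theorem MinimallyGenerates.linearIndependent {S : Set A} {I : TwoSidedIdeal A}
    (h : MinimallyGenerates S I) : LinearIndependent k (Subtype.val : S → A) := by
  rw [linearIndependent_iff_notMem_span]
  intro s hs
  refine h.2 (S \ {(s : A)}) ⟨Set.sdiff_subset, fun hsub => (hsub s.2).2 rfl⟩ ?_
  rw [← h.1]
  refine le_antisymm (TwoSidedIdeal.span_mono Set.sdiff_subset) (TwoSidedIdeal.span_le.2 ?_)
  intro x hx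
  by_cases hxs : x = s
  · subst hxs
    rw [SetLike.mem_coe, ← mkₐ_eq_zero_iff (k := k)]
    refine (Submodule.span_le.2 ?_ : _ ≤ LinearMap.ker (RingCon.mkₐ k
      (TwoSidedIdeal.span (S \ {(s : A)})).ringCon).toLinearMap) hs
    rintro _ ⟨i, ⟨-, hi⟩, rfl⟩
    exact (mkₐ_eq_zero_iff (k := k)).2
      (TwoSidedIdeal.subset_span ⟨i.2, fun h => hi (Subtype.ext h)⟩)
  · exact TwoSidedIdeal.subset_span ⟨hx, hxs⟩

theorem finite_deg_le {𝒜 : ℕ → Submodule k A} (hfin : ∀ n, FiniteDimensional k (𝒜 n)) {S : Set A}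
    {deg : S → ℕ} (hS : ∀ s : S, (s : A) ∈ 𝒜 (deg s))
    (hli : LinearIndependent k (Subtype.val : S → A)) (n : ℕ) : {s | deg s ≤ n}.Finite := by
  refine finite_le_of_finite_eq (fun m => ?_) n
  have := hfin m
  have h1 : LinearIndependent k fun s : {s | deg s = m} =>
      (⟨s.1.1, by have := hS s.1; rwa [s.2] at this⟩ : 𝒜 m) :=
    LinearIndependent.of_comp (𝒜 m).subtype (hli.comp (fun s : {s | deg s = m} => s.1)
      Subtype.val_injective)
  exact h1.finite

end Finiteness

/-! ### Comparison of the two Hilbert series -/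

section Comparison

open scoped NNReal

variable {k A β S : Type*} [Field k] [Ring A] [Algebra k A] {𝒜 : ℕ → Submodule k A}
  {s : S → A} {σ : β → A} {dS : S → ℕ} {dβ : β → ℕ}

theorem tsum_letter_lt_one_of_normalDeg {t : ℝ≥0∞} (ht : t ≠ 0) [Nonempty β]
    (h : ∑' x : β × List (S × β), t ^ normalDeg dS dβ x ≠ ⊤) :
    ∑' l : S × β, t ^ letterDeg dS dβ l < 1 := by
  refine tsum_letter_lt_one fun htop => h ?_
  rw [tsum_normalDeg, htop, ENNReal.mul_top]
  exact (ENNReal.tsum_eq_zero.not.2 fun h0 => pow_ne_zero _ ht (h0 (Classical.arbitrary β)))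

theorem radius_le_one [Nonempty β] [Nonempty S] {F : PowerSeries ℕ}
    (hF : ∀ t, valueAt F t = ∑' x : β × List (S × β), t ^ normalDeg dS dβ x) : radius F ≤ 1 := by
  by_contra! h
  have h1 := valueAt_ne_top_of_lt_radius (t := 1) (by exact_mod_cast h)
  rw [hF] at h1
  have h2 := tsum_letter_lt_one_of_normalDeg (by simp) h1
  refine absurd (ENNReal.le_tsum (f := fun l : S × β => ((1 : ℝ≥0) : ℝ≥0∞) ^ letterDeg dS dβ l)
    (Classical.arbitrary S, Classical.arbitrary β)) (not_le.2 ?_)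
  simpa using h2

/-- If the normal words span the graded algebra `A` but satisfy a linear relation, and if `A(t)` has
the same radius of convergence `r` as the generating function of the normal words, then `A(r)` is
finite: for `t < r` one has `W(t) < 1`, which bounds `A(t) tᵐ` by a constant. -/
theorem valueAt_ne_top_of_not_linearIndependent [GradedAlgebra 𝒜]
    (hfin : ∀ n, FiniteDimensional k (𝒜 n)) (hdS : ∀ i, 0 < dS i)
    (hs : ∀ i, s i ∈ 𝒜 (dS i)) (hσ : ∀ b, σ b ∈ 𝒜 (dβ b))
    (hspan : ∀ n, 𝒜 n ≤ Submodule.span k (normalWord s σ '' {x | normalDeg dS dβ x = n}))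
    [Nonempty β] [Nonempty S] {F : PowerSeries ℕ}
    (hF : ∀ t, valueAt F t = ∑' x : β × List (S × β), t ^ normalDeg dS dβ x) {m : ℕ}
    (hdep : ¬ LinearIndependent k fun x : {x : β × List (S × β) // normalDeg dS dβ x = m} =>
      normalWord s σ x.1)
    {r : ℝ≥0} (hr : 0 < r) (hA : (r : ℝ≥0∞) = radius (hilbertSeries 𝒜))
    (hFr : (r : ℝ≥0∞) = radius F) : valueAt (hilbertSeries 𝒜) r ≠ ⊤ := by
  have i₀ : S := Classical.arbitrary S
  obtain ⟨w₀, hw₀⟩ := exists_wordProd_mem_span i₀ hdep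
  obtain ⟨a, ha⟩ := exists_homogeneous_spanning_family hfin
  have hbound : ∀ t : ℝ≥0, 0 < t → t < r → valueAt (hilbertSeries 𝒜) t *
      (t : ℝ≥0∞) ^ (wordDeg (letterDeg dS dβ) w₀ + dS i₀) ≤ (w₀.length : ℝ≥0) := by
    intro t ht htr
    have htr' : (t : ℝ≥0∞) < r := by exact_mod_cast htr
    have hAt := valueAt_ne_top_of_lt_radius (htr'.trans_eq hA)
    have hFt := valueAt_ne_top_of_lt_radius (htr'.trans_eq hFr)
    rw [hF] at hFt
    have hW := (tsum_letter_lt_one_of_normalDeg (by exact_mod_cast ht.ne') hFt).le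
    have h1 := tsum_finrank_mul_le (le_span_of_wordProd_mem_span hdS hs hσ hw₀ hspan ha)
      fun n => (t : ℝ≥0∞) ^ n
    rw [ENNReal.summable.tsum_sum ENNReal.summable, ENNReal.tsum_prod', ENNReal.tsum_prod'] at h1
    simp only [Sum.elim_inl, Sum.elim_inr, pow_add, ENNReal.tsum_mul_left, ENNReal.tsum_mul_right]
      at h1
    rw [tsum_basisIndex_pow, ← tsum_basisIndex, tsum_basisIndex_pow] at h1
    have h2 := mul_pow_wordDeg_le hW hAt w₀ h1
    calc valueAt (hilbertSeries 𝒜) t * (t : ℝ≥0∞) ^ (wordDeg (letterDeg dS dβ) w₀ + dS i₀)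
        = valueAt (hilbertSeries 𝒜) t * (t : ℝ≥0∞) ^ wordDeg (letterDeg dS dβ) w₀ *
            (t : ℝ≥0∞) ^ dS i₀ := by rw [pow_add, mul_assoc]
      _ ≤ (∑' b, (t : ℝ≥0∞) ^ dβ b) * w₀.length * (t : ℝ≥0∞) ^ dS i₀ := by gcongr
      _ = (∑' b, (t : ℝ≥0∞) ^ dβ b) * (t : ℝ≥0∞) ^ dS i₀ * w₀.length := by ring
      _ ≤ 1 * w₀.length := by gcongr; exact (tsum_mul_pow_le_tsum_letterDeg i₀ _).trans hW
      _ = _ := by simp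
  have h := valueAt_mul_pow_le_of_forall_lt hr hbound
  intro htop
  rw [htop, ENNReal.top_mul (pow_ne_zero _ (by exact_mod_cast hr.ne'))] at h
  exact absurd h (not_le.2 ENNReal.coe_lt_top)

end Comparison

section Main

variable {k A : Type*} [Field k] [Ring A] [Algebra k A] {𝒜 : ℕ → Submodule k A}

/-- The data through which `A` and `C = (A / ASA) * k⟨S⟩` are compared: homogeneous elements `σ b`
of `A`, lifting a basis of `A / ASA`, such that the normal words in the `σ b` and `S` span `A` in
each degree, and the number of those of degree `n` is finite and equal to `dim Cₙ`. -/
theorem exists_normalWord_comparison [GradedAlgebra 𝒜] (hconn : IsConnectedGrading 𝒜) {S : Set A}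
    {deg : S → ℕ} (hdeg : ∀ s : S, 0 < deg s ∧ (s : A) ∈ 𝒜 (deg s))
    (hmin : MinimallyGenerates S (TwoSidedIdeal.span S)) :
    ∃ (β : Type) (dβ : β → ℕ) (σ : β → A), Nonempty β ∧ (∀ b, σ b ∈ 𝒜 (dβ b)) ∧
      (∀ n, 𝒜 n ≤ Submodule.span k
        (normalWord (Subtype.val : S → A) σ '' {x | normalDeg deg dβ x = n})) ∧
      (∀ n, Finite {x : β × List (S × β) // normalDeg deg dβ x = n}) ∧
      ∀ n, FiniteDimensional k (comparisonGrading 𝒜 (TwoSidedIdeal.span S) S deg n) ∧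
        Module.finrank k (comparisonGrading 𝒜 (TwoSidedIdeal.span S) S deg n) =
          Nat.card {x : β × List (S × β) // normalDeg deg dβ x = n} := by
  have hS := fun s => (hdeg s).2
  obtain ⟨b, σ, hb, hbspan, hσ, hA⟩ := exists_quotient_basis hconn.finite hS
  have hspan := le_span_normalWord (s := (Subtype.val : S → A)) (fun s => (hdeg s).1) hA
  have hfinite := finite_normalDeg_eq (dβ := fun i : BasisIndex (quotientGrading 𝒜
    (TwoSidedIdeal.span S)) => i.1) (fun s => (hdeg s).1)
    (finite_deg_le hconn.finite hS hmin.linearIndependent)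
    (finite_le_of_finite_eq fun m => (Set.finite_range (Sigma.mk m)).subset
      (by rintro ⟨_, j⟩ rfl; exact ⟨j, rfl⟩))
  refine ⟨_, _, σ, ?_, hσ, hspan, fun n => (hfinite n).to_subtype, fun n => ?_⟩
  · -- the unit of `A` is not a combination of an empty family
    by_contra hempty
    rw [not_nonempty_iff] at hempty
    have h1 := hspan 0 SetLike.GradedOne.one_mem
    rw [Set.eq_empty_of_isEmpty {x | normalDeg deg _ x = 0}, Set.image_empty,
      Submodule.span_empty, Submodule.mem_bot] at h1
    have := hconn.nontrivial
    exact one_ne_zero h1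
  · have := (hfinite n).fintype
    rw [comparisonGrading, freeProdGrading_eq_span hb hbspan one_mem_quotientGrading
      mul_mem_quotientGrading, Set.image_eq_range]
    refine ⟨FiniteDimensional.span_of_finite k (Set.finite_range _), ?_⟩
    have hli := (linearIndependent_normalWord (S := S) b).comp
      (fun x : {x | normalDeg deg (fun i => i.1) x = n} => x.1) Subtype.val_injective
    exact (finrank_span_eq_card hli).trans Nat.card_eq_fintype_card.symm

end Main

end GradedGrowth

theorem mainTheorem6 {k : Type*} [Field k] {A : Type*} [Ring A] [Algebra k A]
    (𝒜 : ℕ → Submodule k A) [GradedAlgebra 𝒜]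
    (hconn : GradedGrowth.IsConnectedGrading 𝒜)
    (hpos : 0 < GradedGrowth.radius (GradedGrowth.hilbertSeries 𝒜))
    (S : Set A) (hne : S.Nonempty) (deg : S → ℕ)
    (hdeg : ∀ s : S, 0 < deg s ∧ (s : A) ∈ 𝒜 (deg s))
    (I : TwoSidedIdeal A) (hmin : GradedGrowth.MinimallyGenerates S I) :
    (∀ n, FiniteDimensional k (GradedGrowth.comparisonGrading 𝒜 I S deg n)) ∧
    GradedGrowth.radius
        (GradedGrowth.hilbertSeries (GradedGrowth.comparisonGrading 𝒜 I S deg)) ≤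
      GradedGrowth.radius (GradedGrowth.hilbertSeries 𝒜) ∧
    (GradedGrowth.StronglyFree 𝒜 S deg →
      GradedGrowth.radius (GradedGrowth.hilbertSeries 𝒜) =
        GradedGrowth.radius
          (GradedGrowth.hilbertSeries (GradedGrowth.comparisonGrading 𝒜 I S deg))) ∧
    (Algebra.FiniteType k A ∨
        GradedGrowth.valueAt (GradedGrowth.hilbertSeries 𝒜)
          (GradedGrowth.radius (GradedGrowth.hilbertSeries 𝒜)) = ⊤ →
      (GradedGrowth.radius (GradedGrowth.hilbertSeries 𝒜) =
          GradedGrowth.radius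
            (GradedGrowth.hilbertSeries (GradedGrowth.comparisonGrading 𝒜 I S deg)) ↔
        GradedGrowth.StronglyFree 𝒜 S deg)) := by
  open GradedGrowth in
  obtain rfl := hmin.1
  have := hne.to_subtype
  obtain ⟨β, dβ, σ, hβ, hσ, hspan, hfinite, hC⟩ := exists_normalWord_comparison hconn hdeg hmin
  set C := comparisonGrading 𝒜 (TwoSidedIdeal.span S) S deg
  have hle : ∀ n, Module.finrank k (𝒜 n) ≤ Module.finrank k (C n) := fun n => by
    have h := finrank_le_card_of_le_span (hspan n)
    have := hfinite n
    rw [(hC n).2, ← ENat.natCast_le_natCast, ← ENat.card_eq_coe_natCard]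
    exact h
  have hfree : StronglyFree 𝒜 S deg →
      radius (hilbertSeries 𝒜) = radius (hilbertSeries C) := fun h => congrArg radius h.symm
  have hrad : radius (hilbertSeries C) ≤ radius (hilbertSeries 𝒜) :=
    radius_anti fun n => by simpa [hilbertSeries] using hle n
  refine ⟨fun n => (hC n).1, hrad, hfree, fun hdiv => ⟨fun hr => ?_, hfree⟩⟩
  have hF : ∀ t, valueAt (hilbertSeries C) t =
      ∑' x : β × List (S × β), t ^ normalDeg deg dβ x := fun t => by
    rw [tsum_comp_eq_tsum_card (normalDeg deg dβ) fun n => t ^ n]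
    refine tsum_congr fun n => ?_
    have := hfinite n
    rw [ENat.card_eq_coe_natCard]
    simp only [hilbertSeries, PowerSeries.coeff_mk, (hC n).2]
    rfl
  -- this excludes `r(A) = ∞`, where finite generation would not give divergence
  have hrtop : radius (hilbertSeries 𝒜) ≠ ⊤ :=
    ne_top_of_le_ne_top ENNReal.one_ne_top (hr.trans_le (radius_le_one hF))
  have hdiv' : valueAt (hilbertSeries 𝒜) (radius (hilbertSeries 𝒜)) = ⊤ :=
    hdiv.elim (fun h => valueAt_radius_eq_top_of_finiteType hconn h hrtop) id
  by_contra hnot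
  obtain ⟨m, hm⟩ : ∃ m, Module.finrank k (C m) ≠ Module.finrank k (𝒜 m) := by
    by_contra! h
    exact hnot (PowerSeries.ext fun n => by
      simpa only [hilbertSeries, PowerSeries.coeff_mk] using h n)
  have hcoe := ENNReal.coe_toNNReal hrtop
  refine valueAt_ne_top_of_not_linearIndependent hconn.finite (fun s => (hdeg s).1)
    (fun s => (hdeg s).2) hσ hspan hF (m := m) (fun hli => hm ?_)
    (ENNReal.toNNReal_pos hpos.ne' hrtop) hcoe (hcoe.trans hr) (by rw [hcoe]; exact hdiv')
  -- independent normal words of degree `m` in `𝒜 m` would give `dim C m ≤ dim 𝒜 m`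
  refine le_antisymm ?_ (hle m)
  have := Fintype.ofFinite {x : β × List (S × β) // normalDeg deg dβ x = m}
  have := hconn.finite m
  have hcard := finrank_span_eq_card hli
  rw [(hC m).2, Nat.card_eq_fintype_card]
  refine hcard.symm.trans_le (Submodule.finrank_mono (Submodule.span_le.2 ?_))
  rintro _ ⟨⟨x, rfl⟩, rfl⟩
  exact SetLike.GradedMul.mul_mem (hσ x.1) (wordProd_mem (fun s => (hdeg s).2) hσ x.2)
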